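/- Let $X$ be a smooth connected complex projective variety of dimension $2n$, let $L$ be a line bundle on $X$ and $k\ge 1$ an integer such that $L^k$ is very ample (so $L$ is ample). Let $S=|L^k|=\mathbf P(H^0(X,L^k))$ be the complete linear system, for $s\in S$ let $X_s\subset X$ be the corresponding divisor, and let $\mathcal X=\{(x,s)\in X\times S : x\in X_s\}$ be the universal family, with projection $\pi:\mathcal X\to S$. The critical locus $\Sigma\subset\mathcal X$ is the set of points $p\in\mathcal X$ at which the differential $d\pi_p:T_p\mathcal X\to T_{\pi(p)}S$ is not surjective. Let $0\in S$ and let $x$ be an ordinary double point of $X_0$, i.e. a point at which a local equation of $X_0$ in $X$ vanishes together with its differential and has nondegenerate Hessian. Denote by $(\Sigma,x)$ the germ (in the classical topology) of the analytic set $\Sigma$ at the point $(x,0)$. Then the image $(D_x,0)$ of the germ $(\Sigma,x)$ under $\pi$ is well defined, that is, $\pi(\Sigma\cap U)$ has the same germ at $0$ for all sufficiently small neighbourhoods $U$ of $(x,0)$; the projection $\pi$ induces an isomorphism of germs of analytic sets $(\Sigma,x)\cong(D_x,0)$; and both germs are smooth, i.e. germs of complex submanifolds of $X\times S$ and of $S$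 respectively. -/

import Mathlib

open scoped Manifold ContDiff Topology LinearAlgebra.Projectivization

/-! ### Projective space of a finite-dimensional complex vector space, as a complex manifold -/

section ProjectiveSpace

variable {V : Type*} [AddCommGroup V] [Module ℂ V]

theorem rep_mk_eq_smul (v : V) (hv : v ≠ 0) :
    ∃ a : ℂ, a ≠ 0 ∧ (Projectivization.mk ℂ v hv).rep = a • v := by
  obtain ⟨a, ha⟩ := Projectivization.exists_smul_eq_mk_rep ℂ v hv
  exact ⟨a, a.ne_zero, ha.symm⟩

variable [FiniteDimensional ℂ V]

/-- The dimension of the projective space of `V`. -/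
noncomputable abbrev projDim (V : Type*) [AddCommGroup V] [Module ℂ V] : ℕ :=
  Module.finrank ℂ V - 1

theorem exists_homogCoord (s : ℙ ℂ V) :
    ∃ e : V ≃ₗ[ℂ] ℂ × (Fin (projDim V) → ℂ), e s.rep = (1, 0) := by
  obtain ⟨W, hW⟩ := Submodule.exists_isCompl (ℂ ∙ s.rep)
  have h1 := Submodule.finrank_add_eq_of_isCompl hW
  rw [finrank_span_singleton s.rep_nonzero] at h1
  have h2 : Module.finrank ℂ W = Module.finrank ℂ (Fin (projDim V) → ℂ) := by
    rw [Module.finrank_fin_fun]; unfold projDim; omega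
  refine ⟨(Submodule.prodEquivOfIsCompl _ W hW).symm ≪≫ₗ
    LinearEquiv.prodCongr (LinearEquiv.toSpanNonzeroSingleton ℂ V s.rep s.rep_nonzero).symm
      (LinearEquiv.ofFinrankEq _ _ h2), ?_⟩
  have h3 : (Submodule.prodEquivOfIsCompl _ W hW).symm s.rep =
      (⟨s.rep, Submodule.mem_span_singleton_self _⟩, 0) := by
    rw [LinearEquiv.symm_apply_eq]; simp
  have h4 : (LinearEquiv.toSpanNonzeroSingleton ℂ V s.rep s.rep_nonzero).symm
      ⟨s.rep, Submodule.mem_span_singleton_self _⟩ = 1 := by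
    rw [LinearEquiv.symm_apply_eq]
    ext; simp
  rw [LinearEquiv.trans_apply, h3]
  ext <;> simp [h4]

/-- Homogeneous coordinates `(a₀, a)` on `V` in which the point `s` is `[1 : 0]`. -/
noncomputable def homogCoord (s : ℙ ℂ V) : V ≃ₗ[ℂ] ℂ × (Fin (projDim V) → ℂ) :=
  (exists_homogCoord s).choose

theorem homogCoord_rep (s : ℙ ℂ V) : homogCoord s s.rep = (1, 0) :=
  (exists_homogCoord s).choose_spec

/-- The affine slice `a₀ = 1` of the homogeneous coordinates at `s`; `affineLift s t` is the
representative in `V` of the point with affine coordinates `t`. -/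
noncomputable def affineLift (s : ℙ ℂ V) (t : Fin (projDim V) → ℂ) : V :=
  (homogCoord s).symm (1, t)

theorem affineLift_ne_zero (s : ℙ ℂ V) (t : Fin (projDim V) → ℂ) : affineLift s t ≠ 0 := by
  intro h
  have := congrArg (homogCoord s) h
  simp [affineLift] at this

/-- The affine chart `[a₀ : a] ↦ a / a₀` on `{a₀ ≠ 0}`, in the homogeneous coordinates at `s`. -/
noncomputable def affineChart (s : ℙ ℂ V) :
    PartialEquiv (ℙ ℂ V) (Fin (projDim V) → ℂ) where
  toFun p := (homogCoord s p.rep).1⁻¹ • (homogCoord s p.rep).2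
  invFun t := Projectivization.mk ℂ (affineLift s t) (affineLift_ne_zero s t)
  source := {p | (homogCoord s p.rep).1 ≠ 0}
  target := Set.univ
  map_source' _ _ := Set.mem_univ _
  map_target' t _ := by
    obtain ⟨a, ha, h⟩ := rep_mk_eq_smul _ (affineLift_ne_zero s t)
    rw [Set.mem_ofPred_eq, h]
    simp [affineLift, ha]
  left_inv' p hp := by
    conv_rhs => rw [← p.mk_rep]
    rw [Projectivization.mk_eq_mk_iff']
    refine ⟨(homogCoord s p.rep).1⁻¹, ?_⟩
    apply (homogCoord s).injective
    rw [map_smul, affineLift, LinearEquiv.apply_symm_apply]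
    ext <;> simp
    exact inv_mul_cancel₀ hp
  right_inv' t _ := by
    obtain ⟨a, ha, h⟩ := rep_mk_eq_smul _ (affineLift_ne_zero s t)
    ext i
    simp only [h]
    simp [affineLift, ha]

theorem affineChart_trans (s s' : ℙ ℂ V) (t : Fin (projDim V) → ℂ) :
    affineChart s' ((affineChart s).symm t) =
      (homogCoord s' (affineLift s t)).1⁻¹ • (homogCoord s' (affineLift s t)).2 := by
  obtain ⟨a, ha, h⟩ := rep_mk_eq_smul _ (affineLift_ne_zero s t)
  ext i
  simp only [affineChart, PartialEquiv.coe_symm_mk, h, map_smul, Prod.smul_fst, Prod.smul_snd,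
    Pi.smul_apply, smul_eq_mul, mul_inv]
  field_simp

theorem affineChart_trans_source (s s' : ℙ ℂ V) :
    ((affineChart s).symm.trans (affineChart s')).source =
      {t | (homogCoord s' (affineLift s t)).1 ≠ 0} := by
  ext t
  obtain ⟨a, ha, h⟩ := rep_mk_eq_smul _ (affineLift_ne_zero s t)
  simp [affineChart, PartialEquiv.trans_source, h, ha]

theorem contDiff_homogCoord_affineLift (s s' : ℙ ℂ V) :
    ContDiff ℂ ω fun t => homogCoord s' (affineLift s t) := by
  have h : ContDiff ℂ ω (((homogCoord s).symm ≪≫ₗ homogCoord s').toLinearMap.toContinuousLinearMap) :=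
    ContinuousLinearMap.contDiff _
  exact h.comp (contDiff_const.prodMk contDiff_id)

theorem contDiffOn_affineChart_trans (s s' : ℙ ℂ V) :
    ContDiffOn ℂ ω ((affineChart s).symm.trans (affineChart s'))
      ((affineChart s).symm.trans (affineChart s')).source := by
  rw [affineChart_trans_source]
  have h := (contDiff_homogCoord_affineLift s s').contDiffOn
    (s := {t | (homogCoord s' (affineLift s t)).1 ≠ 0})
  refine ((h.fst.inv fun t ht => ht).smul h.snd).congr fun t _ => ?_
  exact affineChart_trans s s' t

/-- The standard atlas of projective space, consisting of all the affine charts. -/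
noncomputable def projAtlas (V : Type*) [AddCommGroup V] [Module ℂ V] [FiniteDimensional ℂ V] :
    ChartedSpaceCore (Fin (projDim V) → ℂ) (ℙ ℂ V) where
  atlas := Set.range affineChart
  chartAt := affineChart
  mem_chart_source s := by simp [affineChart, homogCoord_rep]
  chart_mem_atlas s := Set.mem_range_self s
  open_source := by
    rintro _ _ ⟨s, rfl⟩ ⟨s', rfl⟩
    rw [affineChart_trans_source]
    exact isOpen_ne_fun (contDiff_homogCoord_affineLift s s').continuous.fst continuous_const
  continuousOn_toFun := by
    rintro _ _ ⟨s, rfl⟩ ⟨s', rfl⟩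
    exact (contDiffOn_affineChart_trans s s').continuousOn

noncomputable instance : TopologicalSpace (ℙ ℂ V) := (projAtlas V).toTopologicalSpace

noncomputable instance : ChartedSpace (Fin (projDim V) → ℂ) (ℙ ℂ V) := (projAtlas V).toChartedSpace

instance : IsManifold 𝓘(ℂ, Fin (projDim V) → ℂ) ω (ℙ ℂ V) := by
  apply isManifold_of_contDiffOn
  intro e e' he he'
  replace he := Set.mem_iUnion₂.1 he
  replace he' := Set.mem_iUnion₂.1 he'
  obtain ⟨_, ⟨s, rfl⟩, rfl⟩ := he
  obtain ⟨_, ⟨s', rfl⟩, rfl⟩ := he'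
  have h := contDiffOn_affineChart_trans s s'
  simp only [modelWithCornersSelf_coe, modelWithCornersSelf_coe_symm, Function.comp_id,
    Function.id_comp, Set.preimage_id_eq, id_eq, Set.range_id, Set.inter_univ]
  exact h

end ProjectiveSpace

/-! ### Holomorphic line bundles and their global sections -/

section LineBundle

variable {X : Type*} [TopologicalSpace X] {ι : Type*}

/-- The `k`-th tensor power of the line bundle with transition functions `g i j`: the line bundle
with transition functions `(g i j) ^ k`. -/
noncomputable def VectorBundleCore.tensorPow (L : VectorBundleCore ℂ X ℂ ι) (k : ℕ) :
    VectorBundleCore ℂ X ℂ ι where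
  baseSet := L.baseSet
  isOpen_baseSet := L.isOpen_baseSet
  indexAt := L.indexAt
  mem_baseSet_at := L.mem_baseSet_at
  coordChange i j x := (L.coordChange i j x 1) ^ k • ContinuousLinearMap.id ℂ ℂ
  coordChange_self i x hx v := by simp [L.coordChange_self i x hx]
  continuousOn_coordChange i j :=
    (((L.continuousOn_coordChange i j).clm_apply continuousOn_const).pow k).smul continuousOn_const
  coordChange_comp i j l x hx v := by
    have h : L.coordChange j l x 1 * L.coordChange i j x 1 = L.coordChange i l x 1 := by
      rw [← L.coordChange_comp i j l x hx 1, mul_comm, ← smul_eq_mul, ← map_smul, smul_eq_mul,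
        mul_one]
    simp [← h, mul_pow, mul_assoc]

variable {E : Type*} [NormedAddCommGroup E] [NormedSpace ℂ E] [ChartedSpace E X]

instance (L : VectorBundleCore ℂ X ℂ ι) [L.IsContMDiff 𝓘(ℂ, E) ω] (k : ℕ) :
    (L.tensorPow k).IsContMDiff 𝓘(ℂ, E) ω where
  contMDiffOn_coordChange i j :=
    (((L.contMDiffOn_coordChange 𝓘(ℂ, E) i j).clm_apply contMDiffOn_const).pow k).smul
      contMDiffOn_const

/-- `H⁰(X, Z)`: the space of global holomorphic sections of the line bundle `Z`. -/
abbrev HolSections (E : Type*) [NormedAddCommGroup E] [NormedSpace ℂ E] [ChartedSpace E X]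
    (Z : VectorBundleCore ℂ X ℂ ι) : Type _ :=
  ContMDiffSection 𝓘(ℂ, E) ℂ ω Z.Fiber

/-- The holomorphic function which represents the section `σ` near `x`, in the local
trivialization of the line bundle at `x`. -/
noncomputable def localRep {Z : VectorBundleCore ℂ X ℂ ι} (σ : HolSections E Z) (x y : X) : ℂ :=
  Z.coordChange (Z.indexAt y) (Z.indexAt x) y (σ y)

theorem localRep_transition {Z : VectorBundleCore ℂ X ℂ ι} (σ : HolSections E Z) {p q y : X}
    (hp : y ∈ Z.baseSet (Z.indexAt p)) (hq : y ∈ Z.baseSet (Z.indexAt q)) :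
    Z.coordChange (Z.indexAt q) (Z.indexAt p) y (localRep σ q y) = localRep σ p y :=
  Z.coordChange_comp _ _ _ y ⟨⟨Z.mem_baseSet_at y, hq⟩, hp⟩ _

theorem localRep_self {Z : VectorBundleCore ℂ X ℂ ι} (σ : HolSections E Z) (y : X) :
    localRep σ y y = σ y :=
  Z.coordChange_self _ y (Z.mem_baseSet_at y) _

theorem contMDiffOn_localRep [IsManifold 𝓘(ℂ, E) ω X] {Z : VectorBundleCore ℂ X ℂ ι}
    [Z.IsContMDiff 𝓘(ℂ, E) ω] (σ : HolSections E Z) (p : X) :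
    ContMDiffOn 𝓘(ℂ, E) 𝓘(ℂ, ℂ) ω (localRep σ p) (Z.baseSet (Z.indexAt p)) :=
  ((trivializationAt ℂ Z.Fiber p).contMDiffOn_section_baseSet_iff (IB := 𝓘(ℂ, E))
    (s := fun y => σ y)).1 σ.contMDiff.contMDiffOn

theorem differentiableOn_localRep [IsManifold 𝓘(ℂ, E) ω X] {Z : VectorBundleCore ℂ X ℂ ι}
    [Z.IsContMDiff 𝓘(ℂ, E) ω] (σ : HolSections E Z) (p : X) :
    DifferentiableOn ℂ (fun z => localRep σ p ((extChartAt 𝓘(ℂ, E) p).symm z))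
      ((extChartAt 𝓘(ℂ, E) p).target ∩
        (extChartAt 𝓘(ℂ, E) p).symm ⁻¹' Z.baseSet (Z.indexAt p)) := by
  have h := (contMDiffOn_localRep σ p).comp
    ((contMDiffOn_extChartAt_symm (I := 𝓘(ℂ, E)) (n := ω) p).mono Set.inter_subset_left)
    (t := Z.baseSet (Z.indexAt p)) (s := (extChartAt 𝓘(ℂ, E) p).target ∩
        (extChartAt 𝓘(ℂ, E) p).symm ⁻¹' Z.baseSet (Z.indexAt p)) fun z hz => hz.2
  exact (contMDiffOn_iff_contDiffOn.1 h).differentiableOn (by simp)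

/-- There are finitely many points such that a holomorphic section vanishing at all of them is
zero. -/
theorem exists_finite_determining [FiniteDimensional ℂ E] [IsManifold 𝓘(ℂ, E) ω X]
    [CompactSpace X] [T2Space X] (Z : VectorBundleCore ℂ X ℂ ι) [Z.IsContMDiff 𝓘(ℂ, E) ω] :
    ∃ N : Finset X, ∀ σ : HolSections E Z, (∀ y ∈ N, σ y = 0) → σ = 0 := by
  classical
  have : ProperSpace E := FiniteDimensional.proper ℂ E
  let φ (p : X) := extChartAt 𝓘(ℂ, E) p
  have hφ (p : X) : φ p = extChartAt 𝓘(ℂ, E) p := rfl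
  have hball (p : X) : ∃ ρ > 0, Metric.closedBall (φ p p) (2 * ρ) ⊆
      (φ p).target ∩ (φ p).symm ⁻¹' Z.baseSet (Z.indexAt p) := by
    have h1 : (φ p).target ∩ (φ p).symm ⁻¹' Z.baseSet (Z.indexAt p) ∈ 𝓝 (φ p p) := by
      refine Filter.inter_mem (extChartAt_target_mem_nhds p) ?_
      apply (continuousAt_extChartAt_symm p).preimage_mem_nhds
      rw [extChartAt_to_inv]
      exact (Z.isOpen_baseSet _).mem_nhds (Z.mem_baseSet_at p)
    obtain ⟨ε, hε, h⟩ := Metric.nhds_basis_closedBall.mem_iff.1 h1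
    exact ⟨ε / 2, by positivity, by rwa [mul_div_cancel₀ _ two_ne_zero]⟩
  choose ρ hρ hsub using hball
  obtain ⟨t, ht⟩ := CompactSpace.elim_nhds_subcover
    (fun p => (φ p).source ∩ (φ p) ⁻¹' Metric.ball (φ p p) (ρ p)) fun p =>
      Filter.inter_mem (extChartAt_source_mem_nhds p)
        ((continuousAt_extChartAt p).preimage_mem_nhds (Metric.ball_mem_nhds _ (hρ p)))
  have hcov (y : X) : ∃ q ∈ t, y ∈ (φ q).source ∧ φ q y ∈ Metric.ball (φ q q) (ρ q) := by
    have : y ∈ (⊤ : Set X) := trivial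
    rw [← ht] at this
    obtain ⟨q, hq, h⟩ := Set.mem_iUnion₂.1 this
    exact ⟨q, hq, h⟩
  let K (p : X) := (φ p).symm '' Metric.closedBall (φ p p) (2 * ρ p)
  have hK (p : X) : IsCompact (K p) :=
    (isCompact_closedBall _ _).image_of_continuousOn
      ((continuousOn_extChartAt_symm p).mono fun z hz => (hsub p hz).1)
  have hKb (p : X) : K p ⊆ Z.baseSet (Z.indexAt p) := by
    rintro _ ⟨z, hz, rfl⟩
    exact (hsub p hz).2
  have hC (p q : X) : ∃ C : ℝ, ∀ y ∈ K p ∩ K q,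
      ‖Z.coordChange (Z.indexAt q) (Z.indexAt p) y‖ ≤ C :=
    ((hK p).inter (hK q)).exists_bound_of_continuousOn
      ((Z.continuousOn_coordChange _ _).mono fun y hy => ⟨hKb q hy.2, hKb p hy.1⟩)
  choose C hC using hC
  let A : ℝ := 1 + ∑ p ∈ t, ∑ q ∈ t, |C p q|
  have hA1 : 1 ≤ A := le_add_of_nonneg_right (by positivity)
  have hA (p q : X) (hp : p ∈ t) (hq : q ∈ t) : C p q ≤ A :=
    calc C p q ≤ |C p q| := le_abs_self _
      _ ≤ ∑ q ∈ t, |C p q| := Finset.single_le_sum (f := fun q => |C p q|)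
          (fun _ _ => abs_nonneg _) hq
      _ ≤ ∑ p ∈ t, ∑ q ∈ t, |C p q| := Finset.single_le_sum (f := fun p => ∑ q ∈ t, |C p q|)
          (fun _ _ => by positivity) hp
      _ ≤ A := by simp [A]
  have hnet (q : X) := (isCompact_closedBall (φ q q) (ρ q)).finite_cover_balls
    (e := ρ q / (2 * A)) (by have := hρ q; positivity)
  choose net hnet1 hnet2 hnet3 using hnet
  refine ⟨t.biUnion fun q => (hnet2 q).toFinset.image (φ q).symm, fun σ hσ => ?_⟩
  have hzero (q : X) (hq : q ∈ t) (w : E) (hw : w ∈ net q) :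
      localRep σ q ((φ q).symm w) = 0 := by
    have h := hσ ((φ q).symm w) (Finset.mem_biUnion.2
      ⟨q, hq, Finset.mem_image.2 ⟨w, by simpa using hw, rfl⟩⟩)
    rw [localRep, h]
    exact map_zero (Z.coordChange (Z.indexAt ((φ q).symm w)) (Z.indexAt q) ((φ q).symm w))
  have step (M : ℝ) (hM : ∀ p ∈ t, ∀ z ∈ Metric.closedBall (φ p p) (2 * ρ p),
      ‖localRep σ p ((φ p).symm z)‖ ≤ M) : ∀ p ∈ t, ∀ z ∈ Metric.closedBall (φ p p) (2 * ρ p),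
      ‖localRep σ p ((φ p).symm z)‖ ≤ M / 2 := by
    intro p hp z hz
    obtain ⟨q, hq, hyq, hyb⟩ := hcov ((φ p).symm z)
    set y := (φ p).symm z with hy
    have hM0 : 0 ≤ M := (norm_nonneg _).trans (hM p hp z hz)
    have hyq' : (φ q).symm (φ q y) = y := (φ q).left_inv hyq
    have hyb2 : φ q y ∈ Metric.closedBall (φ q q) (2 * ρ q) := by
      have := hρ q
      rw [Metric.mem_ball] at hyb
      rw [Metric.mem_closedBall]
      linarith
    have hyKp : y ∈ K p := ⟨z, hz, rfl⟩
    have hyKq : y ∈ K q := ⟨φ q y, hyb2, hyq'⟩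
    obtain ⟨w, hw, hwd⟩ : ∃ w ∈ net q, φ q y ∈ Metric.ball w (ρ q / (2 * A)) := by
      simpa using hnet3 q (Metric.ball_subset_closedBall hyb)
    have hsubw : Metric.ball w (ρ q) ⊆ Metric.closedBall (φ q q) (2 * ρ q) := by
      intro u hu
      have h1 := hnet1 q hw
      rw [Metric.mem_closedBall] at h1 ⊢
      rw [Metric.mem_ball] at hu
      have := dist_triangle u w (φ q q)
      linarith
    have hle : ρ q / (2 * A) ≤ ρ q := div_le_self (hρ q).le (by linarith)
    have hS := Complex.dist_le_div_mul_dist_of_mapsTo_ball (R₂ := M)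
      ((differentiableOn_localRep σ q).mono (hsubw.trans (hsub q)))
      (fun u hu => by
        have h0 := hzero q hq w hw
        rw [hφ] at h0
        simp only [h0]
        rw [mem_closedBall_zero_iff]
        exact hM q hq u (hsubw hu))
      (Metric.ball_subset_ball hle hwd)
    have h0 := hzero q hq w hw
    rw [← hφ] at hS
    rw [h0, hyq', dist_zero_right] at hS
    have hq2 : ‖localRep σ q y‖ ≤ M / (2 * A) := by
      have := hρ q
      rw [Metric.mem_ball] at hwd
      calc _ ≤ M / ρ q * dist (φ q y) w := hS
        _ ≤ M / ρ q * (ρ q / (2 * A)) := by gcongr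
        _ = M / (2 * A) := by field_simp
    rw [← localRep_transition σ (hKb p hyKp) (hKb q hyKq)]
    calc _ ≤ ‖Z.coordChange (Z.indexAt q) (Z.indexAt p) y‖ * ‖localRep σ q y‖ :=
          ContinuousLinearMap.le_opNorm _ _
      _ ≤ A * (M / (2 * A)) := by
          gcongr
          exact (hC p q y ⟨hyKp, hyKq⟩).trans (hA p q hp hq)
      _ = M / 2 := by field_simp
  have hB (p : X) : ∃ B : ℝ, ∀ z ∈ Metric.closedBall (φ p p) (2 * ρ p),
      ‖localRep σ p ((φ p).symm z)‖ ≤ B :=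
    (isCompact_closedBall _ _).exists_bound_of_continuousOn
      ((differentiableOn_localRep σ p).mono (hsub p)).continuousOn
  choose B hB using hB
  have hall (j : ℕ) : ∀ p ∈ t, ∀ z ∈ Metric.closedBall (φ p p) (2 * ρ p),
      ‖localRep σ p ((φ p).symm z)‖ ≤ (∑ p ∈ t, |B p|) * (1 / 2) ^ j := by
    induction j with
    | zero =>
      intro p hp z hz
      rw [pow_zero, mul_one]
      exact ((hB p z hz).trans (le_abs_self _)).trans
        (Finset.single_le_sum (f := fun p => |B p|) (fun _ _ => abs_nonneg _) hp)
    | succ j ih =>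
      intro p hp z hz
      refine (step _ ih p hp z hz).trans_eq ?_
      ring
  ext y
  obtain ⟨q, hq, hyq, hyb⟩ := hcov y
  have hyb2 : φ q y ∈ Metric.closedBall (φ q q) (2 * ρ q) := by
    have := hρ q
    rw [Metric.mem_ball] at hyb
    rw [Metric.mem_closedBall]
    linarith
  have hyq' : (φ q).symm (φ q y) = y := (φ q).left_inv hyq
  have hlim : Filter.Tendsto (fun j : ℕ => (∑ p ∈ t, |B p|) * (1 / 2 : ℝ) ^ j) Filter.atTop (𝓝 0) := by
    simpa using (tendsto_pow_atTop_nhds_zero_of_lt_one (r := (1 / 2 : ℝ)) (by norm_num)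
      (by norm_num)).const_mul (∑ p ∈ t, |B p|)
  have hz : localRep σ q y = 0 := by
    have := ge_of_tendsto' hlim fun j => hall j q hq _ hyb2
    rw [hyq'] at this
    exact norm_le_zero_iff.1 this
  have hfin := localRep_transition σ (Z.mem_baseSet_at y) (hKb q ⟨φ q y, hyb2, hyq'⟩)
  rw [hz, map_zero, localRep_self] at hfin
  exact hfin.symm

instance [FiniteDimensional ℂ E] [IsManifold 𝓘(ℂ, E) ω X] [CompactSpace X] [T2Space X]
    (Z : VectorBundleCore ℂ X ℂ ι) [Z.IsContMDiff 𝓘(ℂ, E) ω] :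
    FiniteDimensional ℂ (HolSections E Z) := by
  obtain ⟨N, hN⟩ := exists_finite_determining (E := E) Z
  let ev : HolSections E Z →ₗ[ℂ] (N → ℂ) :=
    { toFun := fun σ y => σ y.1
      map_add' := fun _ _ => rfl
      map_smul' := fun _ _ => rfl }
  refine FiniteDimensional.of_injective ev ((injective_iff_map_eq_zero ev).2 fun σ h => ?_)
  exact hN σ fun y hy => congrFun h ⟨y, hy⟩

end LineBundle

/-! ### Germs of analytic subsets of complex manifolds -/

section Germs

variable {E₁ H₁ M E₂ H₂ N : Type*}
  [NormedAddCommGroup E₁] [NormedSpace ℂ E₁] [TopologicalSpace H₁] (I : ModelWithCorners ℂ E₁ H₁)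
  [TopologicalSpace M] [ChartedSpace H₁ M]
  [NormedAddCommGroup E₂] [NormedSpace ℂ E₂] [TopologicalSpace H₂] (J : ModelWithCorners ℂ E₂ H₂)
  [TopologicalSpace N] [ChartedSpace H₂ N]

/-- The germ at `p` of the subset `A` of the complex manifold `M` is smooth: near `p`, the set `A`
is a complex submanifold, i.e. the zero set of a holomorphic submersion to some `ℂ ^ c`. -/
def IsSmoothGerm (A : Set M) (p : M) : Prop :=
  ∃ (c : ℕ) (G : M → (Fin c → ℂ)), ContMDiffAt I 𝓘(ℂ, Fin c → ℂ) ω G p ∧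
    Function.Surjective (mfderiv I 𝓘(ℂ, Fin c → ℂ) G p) ∧ G p = 0 ∧
    ∀ᶠ y in 𝓝 p, (y ∈ A ↔ G y = 0)

/-- The map `f` induces an isomorphism of germs of (reduced) analytic sets `(A, p) ≅ (B, f p)`:
it is holomorphic near `p`, and there is a map `g`, holomorphic near `f p`, such that `f` and `g`
restrict to mutually inverse maps between `A` near `p` and `B` near `f p`. -/
def IsGermIso (f : M → N) (A : Set M) (p : M) (B : Set N) : Prop :=
  p ∈ A ∧ f p ∈ B ∧ ContMDiffAt I J ω f p ∧
    ∃ g : N → M, g (f p) = p ∧ ContMDiffAt J I ω g (f p) ∧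
      (∀ᶠ y in 𝓝 p, y ∈ A → f y ∈ B ∧ g (f y) = y) ∧
      (∀ᶠ z in 𝓝 (f p), z ∈ B → g z ∈ A ∧ f (g z) = z)

/-- The germ of `B` at `f p` is the image by `f` of the germ of `A` at `p`: the image of
`A ∩ U` has this germ, for all sufficiently small neighbourhoods `U` of `p`. -/
def IsImageGerm {M N : Type*} [TopologicalSpace M] [TopologicalSpace N]
    (f : M → N) (A : Set M) (p : M) (B : Set N) : Prop :=
  ∃ U₀ ∈ 𝓝 p, ∀ U ∈ 𝓝 p, U ⊆ U₀ → ∀ᶠ z in 𝓝 (f p), (z ∈ f '' (A ∩ U) ↔ z ∈ B)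

end Germs

/-! ### The linear system of a line bundle and its universal family -/

section Family

variable {X : Type*} [TopologicalSpace X] {ι : Type*}
  (E : Type*) [NormedAddCommGroup E] [NormedSpace ℂ E] [ChartedSpace E X]
  (Z : VectorBundleCore ℂ X ℂ ι)

/-- The line bundle `Z` is very ample: its global sections have no base points, separate points
and separate tangent vectors (so they embed the compact manifold `X` in a projective space). -/
def IsVeryAmple : Prop :=
  (∀ x : X, ∃ σ : HolSections E Z, σ x ≠ 0) ∧
  (∀ x y : X, x ≠ y → ∃ σ : HolSections E Z, σ x = 0 ∧ σ y ≠ 0) ∧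
  (∀ (x : X) (v : TangentSpace 𝓘(ℂ, E) x), v ≠ 0 → ∃ σ : HolSections E Z,
    σ x = 0 ∧ mfderiv 𝓘(ℂ, E) 𝓘(ℂ, ℂ) (localRep σ x) x v ≠ 0)

/-- The complete linear system `|Z|`, i.e. the projective space of lines in `H⁰(X, Z)`; its points
are the zero divisors of the nonzero sections of `Z`. -/
abbrev LinearSystem : Type _ := ℙ ℂ (HolSections E Z)

variable {E Z}

/-- A point `x` is an ordinary double point of the divisor `X_s` of `s ∈ |Z|`: in local coordinates,
the local equation of `X_s` vanishes at `x` together with its differential, and its Hessian at `x`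
is nondegenerate. -/
def IsOrdinaryDoublePoint (s : LinearSystem E Z) (x : X) : Prop :=
  let f : E → ℂ := fun z => localRep s.rep x ((extChartAt 𝓘(ℂ, E) x).symm z)
  let c : E := extChartAt 𝓘(ℂ, E) x x
  f c = 0 ∧ fderiv ℂ f c = 0 ∧ ∀ u : E, (∀ v : E, fderiv ℂ (fderiv ℂ f) c u v = 0) → u = 0

variable (E Z)

/-- The universal family `𝒳 = ∐_s X_s` as a subset of `X × |Z|`. -/
def universalFamily : Set (X × LinearSystem E Z) :=
  {p | p.2.rep p.1 = 0}

variable {E Z}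
variable [FiniteDimensional ℂ (HolSections E Z)]

/-- The local equation of the universal family near `p = (x, s)`: the value at `(y, t)` is that of
the section `t`, normalized by the affine coordinates of `|Z|` at `s`, in the local trivialization
of the line bundle at `x`. -/
noncomputable def familyEquation (p q : X × LinearSystem E Z) : ℂ :=
  localRep (affineLift p.2 (affineChart p.2 q.2)) p.1 q.1

/-- The tangent space at `p` of the universal family, inside the tangent space of `X × |Z|`: the
kernel of the differential of the local equation. -/
noncomputable def familyTangentSpace (p : X × LinearSystem E Z) :
    Submodule ℂ (TangentSpace
      (𝓘(ℂ, E).prod 𝓘(ℂ, Fin (projDim (HolSections E Z)) → ℂ)) p) :=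
  (mfderiv (𝓘(ℂ, E).prod 𝓘(ℂ, Fin (projDim (HolSections E Z)) → ℂ)) 𝓘(ℂ, ℂ)
    (familyEquation p) p).ker

variable (E Z)

/-- The critical locus of the projection `𝒳 → |Z|` of the universal family: the points at which
the differential `T_p 𝒳 → T_s |Z|` is not surjective. -/
def criticalLocus : Set (X × LinearSystem E Z) :=
  {p | p ∈ universalFamily E Z ∧
    (familyTangentSpace p).map
      (mfderiv (𝓘(ℂ, E).prod 𝓘(ℂ, Fin (projDim (HolSections E Z)) → ℂ))
        𝓘(ℂ, Fin (projDim (HolSections E Z)) → ℂ) Prod.snd p).toLinearMap ≠ ⊤}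

end Family

/-! Take a chart of `X` at `x₀`, a trivialization of the line bundle there, and affine coordinates
`t` on the linear system centred at `s₀`. The universal family is then `F (z, t) = 0`, where `F` is
holomorphic and affine in `t`. As `x₀` is not a base point, the derivative of `F` in `t` at the
double point is nonzero.

At any point of the family, the derivative of the local equation in the direction of the linear
system is a nonzero linear form, again because there are no base points. So the kernel of the full
differential projects onto the tangent space of the linear system unless the derivative along `X`
vanishes (`map_snd_ker_ne_top_iff`). Hence the critical locus is the set where the 1-jet of the
section vanishes (`mem_criticalLocus_iff`). This condition depends neither on the chart, nor on the
trivialization, nor on the scaling of the section (`oneJet_eq_zero_iff`, `affineLift_affineChart`),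
so near the double point it reads `F = 0`, `∂F/∂z = 0` in one fixed system of coordinates.

The nondegenerate Hessian lets the implicit function theorem solve `∂F/∂z = 0` by `z = ζ t`. What
remains is the equation `h t = F (ζ t, t) = 0` for the critical value. Since `∂F/∂z` vanishes at the
double point, `dh` equals `∂F/∂t` there, which is nonzero (`exists_critical_point_map`). The
critical locus is thus a graph over the smooth hypersurface `h = 0`, which is its image
(`exists_image_germ_of_graph`). -/

/-! ### Nondegenerate critical points in a family of holomorphic functions. -/

section Calculus

variable {E T : Type*} [NormedAddCommGroup E] [NormedSpace ℂ E]
  [NormedAddCommGroup T] [NormedSpace ℂ T]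

/-- The partial derivative along the first factor. -/
noncomputable def partialFst (F : E × T → ℂ) (p : E × T) : E →L[ℂ] ℂ :=
  (fderiv ℂ F p).comp (ContinuousLinearMap.inl ℂ E T)

theorem DifferentiableAt.fderiv_slice_eq_partialFst {F : E × T → ℂ} {p : E × T}
    (hF : DifferentiableAt ℂ F p) : fderiv ℂ (fun z => F (z, p.2)) p.1 = partialFst F p :=
  (HasFDerivAt.comp p.1 (g := F) (f := fun z => (z, p.2)) hF.hasFDerivAt
    (hasFDerivAt_prodMk_left p.1 p.2)).fderiv

theorem ContDiffAt.partialFst [CompleteSpace E] [CompleteSpace T] {F : E × T → ℂ} {p : E × T}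
    (hF : ContDiffAt ℂ ω F p) : ContDiffAt ℂ ω (partialFst F) p :=
  (hF.fderiv_right (m := ω) (by simp)).clm_comp contDiffAt_const

/-- The locus of critical points with value zero of a family `F (·, t)` of holomorphic functions,
near a nondegenerate critical point with value zero: it is the graph of a holomorphic map `ζ` over
the zero set of the critical value `t ↦ F (ζ t, t)`. -/
theorem exists_critical_point_map [FiniteDimensional ℂ E] [FiniteDimensional ℂ T]
    {F : E × T → ℂ} {c : E} {t₀ : T}
    (hF : ContDiffAt ℂ ω F (c, t₀)) (hd : fderiv ℂ (fun z => F (z, t₀)) c = 0)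
    (hH : ∀ u : E, (∀ v : E, fderiv ℂ (fderiv ℂ (fun z => F (z, t₀))) c u v = 0) → u = 0)
    (ht : fderiv ℂ (fun t => F (c, t)) t₀ ≠ 0) :
    ∃ ζ : T → E, ζ t₀ = c ∧ ContDiffAt ℂ ω ζ t₀ ∧ ContDiffAt ℂ ω (fun t => F (ζ t, t)) t₀ ∧
      fderiv ℂ (fun t => F (ζ t, t)) t₀ ≠ 0 ∧
      ∀ᶠ p in 𝓝 (c, t₀),
        ((F p = 0 ∧ fderiv ℂ (fun z => F (z, p.2)) p.1 = 0) ↔ (p.1 = ζ p.2 ∧ F (ζ p.2, p.2) = 0)) := by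
  have : CompleteSpace E := FiniteDimensional.complete ℂ E
  have : CompleteSpace T := FiniteDimensional.complete ℂ T
  have hdiff : ∀ᶠ p in 𝓝 (c, t₀), DifferentiableAt ℂ F p :=
    (hF.eventually (by simp)).mono fun p hp => hp.differentiableAt (by simp)
  have hslice : ∀ᶠ p in 𝓝 (c, t₀), fderiv ℂ (fun z => F (z, p.2)) p.1 = partialFst F p :=
    hdiff.mono fun p hp => hp.fderiv_slice_eq_partialFst
  have hP := hF.partialFst
  have hPd : HasFDerivAt (partialFst F) (fderiv ℂ (partialFst F) (c, t₀)) (c, t₀) :=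
    (hP.differentiableAt (by simp)).hasFDerivAt
  have hP0 : partialFst F (c, t₀) = 0 := by rw [← hslice.self_of_nhds, hd]
  -- the Hessian is the derivative of `partialFst F` along the first factor
  have hHess : fderiv ℂ (fderiv ℂ fun z => F (z, t₀)) c =
      (fderiv ℂ (partialFst F) (c, t₀)).comp (ContinuousLinearMap.inl ℂ E T) := by
    have h1 : (fderiv ℂ fun z => F (z, t₀)) =ᶠ[𝓝 c] fun z => partialFst F (z, t₀) :=
      (Continuous.prodMk_left t₀).continuousAt.eventually hslice
    rw [h1.fderiv_eq]
    exact (HasFDerivAt.comp c (g := partialFst F) (f := fun z => (z, t₀)) hPd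
      (hasFDerivAt_prodMk_left c t₀)).fderiv
  -- straighten `F` by swapping the factors
  let Q : T × E → (E →L[ℂ] ℂ) := fun q => partialFst F (q.2, q.1)
  have hQ : ContDiffAt ℂ ω Q (t₀, c) :=
    ContDiffAt.comp (t₀, c) (f := fun q : T × E => (q.2, q.1)) hP
      (contDiffAt_snd.prodMk contDiffAt_fst)
  have hQd : (fderiv ℂ Q (t₀, c)).comp (ContinuousLinearMap.inr ℂ T E) =
      fderiv ℂ (fderiv ℂ fun z => F (z, t₀)) c := by
    have h2 : HasFDerivAt Q ((fderiv ℂ (partialFst F) (c, t₀)).comp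
        ((ContinuousLinearMap.snd ℂ T E).prod (ContinuousLinearMap.fst ℂ T E))) (t₀, c) :=
      HasFDerivAt.comp (t₀, c) (f := fun q : T × E => (q.2, q.1)) (g := partialFst F) hPd
        (hasFDerivAt_snd.prodMk hasFDerivAt_fst)
    rw [h2.fderiv, hHess]
    ext; simp
  -- Nondegeneracy says that the Hessian `E → E*` is injective; equality of dimensions makes it
  -- invertible.
  have hinv : ((fderiv ℂ Q (t₀, c)).comp (ContinuousLinearMap.inr ℂ T E)).IsInvertible := by
    rw [hQd]
    have hinj : Function.Injective (fderiv ℂ (fderiv ℂ fun z => F (z, t₀)) c) := by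
      rw [injective_iff_map_eq_zero]
      intro u hu
      exact hH u fun v => by rw [hu]; rfl
    have hrank : Module.finrank ℂ E = Module.finrank ℂ (E →L[ℂ] ℂ) := by
      rw [← (LinearMap.toContinuousLinearMap (𝕜 := ℂ) (E := E) (F' := ℂ)).finrank_eq]
      exact (Subspace.dual_finrank_eq).symm
    refine ⟨(LinearMap.linearEquivOfInjective
      (fderiv ℂ (fderiv ℂ fun z => F (z, t₀)) c).toLinearMap hinj hrank).toContinuousLinearEquiv, ?_⟩
    ext; rfl
  let ζ := ContDiffAt.implicitFunction hQ (by simp) hinv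
  have hζ0 : ζ t₀ = c := ContDiffAt.implicitFunction_apply_self hQ (by simp) hinv
  have hζ : ContDiffAt ℂ ω ζ t₀ := ContDiffAt.contDiffAt_implicitFunction hQ (by simp) hinv
  have hFζ : ContDiffAt ℂ ω F (ζ t₀, t₀) := by rwa [hζ0]
  refine ⟨ζ, hζ0, hζ, ContDiffAt.comp t₀ (f := fun t => (ζ t, t)) hFζ (hζ.prodMk contDiffAt_id), ?_, ?_⟩
  · have hFd := hdiff.self_of_nhds.hasFDerivAt
    have h1 : HasFDerivAt (fun t => F (ζ t, t)) ((fderiv ℂ F (c, t₀)).comp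
        ((fderiv ℂ ζ t₀).prod (ContinuousLinearMap.id ℂ T))) t₀ := by
      refine HasFDerivAt.comp t₀ (f := fun t => (ζ t, t)) (g := F) ?_
        ((hζ.differentiableAt (by simp)).hasFDerivAt.prodMk (hasFDerivAt_id t₀))
      rwa [hζ0]
    have h2 : fderiv ℂ (fun t => F (c, t)) t₀ =
        (fderiv ℂ F (c, t₀)).comp (ContinuousLinearMap.inr ℂ E T) :=
      (HasFDerivAt.comp t₀ (g := F) (f := fun t => (c, t)) hFd
        (hasFDerivAt_prodMk_right c t₀)).fderiv
    -- The variation of `ζ` does not contribute to first order, because `c` is a critical point of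
    -- `F (·, t₀)`.
    have h3 : fderiv ℂ (fun t => F (ζ t, t)) t₀ = fderiv ℂ (fun t => F (c, t)) t₀ := by
      rw [h1.fderiv, h2]
      ext τ
      have h4 : fderiv ℂ F (c, t₀) (fderiv ℂ ζ t₀ τ, 0) = 0 :=
        congrArg (fun l : E →L[ℂ] ℂ => l (fderiv ℂ ζ t₀ τ)) hP0
      have h5 : ((fderiv ℂ ζ t₀ τ, τ) : E × T) = (fderiv ℂ ζ t₀ τ, 0) + (0, τ) := by simp
      simp only [ContinuousLinearMap.comp_apply, ContinuousLinearMap.prod_apply,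
        ContinuousLinearMap.id_apply, ContinuousLinearMap.inr_apply]
      rw [h5, map_add, h4, zero_add]
    rwa [h3]
  · have h1 := ContDiffAt.eventually_apply_eq_iff_implicitFunction hQ (by simp) hinv
    have h2 : ∀ᶠ p in 𝓝 (c, t₀), (Q (p.2, p.1) = Q (t₀, c) ↔ ζ p.2 = p.1) :=
      (continuous_swap.continuousAt (x := (c, t₀))).eventually h1
    filter_upwards [h2, hslice] with p hp hs
    rw [hs]
    have h3 : Q (t₀, c) = 0 := hP0
    have h4 : Q (p.2, p.1) = partialFst F p := rfl
    rw [h3, h4] at hp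
    rw [hp]
    constructor
    · rintro ⟨h, h'⟩
      exact ⟨h'.symm, by rw [h']; exact h⟩
    · rintro ⟨h, h'⟩
      rw [← h] at h'
      exact ⟨h', h.symm⟩

end Calculus

/-! ### Affine representatives of points of projective space. -/

section ProjectiveSpace

variable {V : Type*} [AddCommGroup V] [Module ℂ V] [FiniteDimensional ℂ V]

theorem affineLift_eq_add (s : ℙ ℂ V) (t : Fin (projDim V) → ℂ) :
    affineLift s t = s.rep + (homogCoord s).symm (0, t) := by
  apply (homogCoord s).injective
  simp [affineLift, homogCoord_rep]

theorem affineChart_self (s : ℙ ℂ V) : affineChart s s = 0 := by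
  simp [affineChart, homogCoord_rep]

theorem affineLift_affineChart_self (s : ℙ ℂ V) : affineLift s (affineChart s s) = s.rep := by
  simp [affineLift_eq_add, affineChart_self]

/-- The representative `p.rep` is an arbitrary choice with no regularity in `p`, while the affine
lift is holomorphic in the coordinates. They differ by a nonzero scalar, which is harmless for the
vanishing of a jet. -/
theorem affineLift_affineChart {s p : ℙ ℂ V} (hp : p ∈ (affineChart s).source) :
    ∃ a : ℂ, a ≠ 0 ∧ affineLift s (affineChart s p) = a • p.rep := by
  refine ⟨(homogCoord s p.rep).1⁻¹, inv_ne_zero hp, (homogCoord s).injective ?_⟩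
  rw [map_smul, affineLift, LinearEquiv.apply_symm_apply]
  ext <;> simp [affineChart]
  exact (inv_mul_cancel₀ hp).symm

theorem extChartAt_eq_affineChart (s : ℙ ℂ V) :
    extChartAt 𝓘(ℂ, Fin (projDim V) → ℂ) s = affineChart s := by
  simp only [extChartAt, OpenPartialHomeomorph.extend, modelWithCornersSelf_partialEquiv,
    PartialEquiv.trans_refl]
  rfl

end ProjectiveSpace

/-! ### Values and 1-jets of sections in local trivializations. -/

section LocalRep

variable {X : Type*} [TopologicalSpace X] {ι : Type*}
  {E : Type*} [NormedAddCommGroup E] [NormedSpace ℂ E] [ChartedSpace E X]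
  {Z : VectorBundleCore ℂ X ℂ ι}

/-- The value at `y` of sections of a line bundle, in the local trivialization at `x`, as a linear
form. -/
noncomputable def localRepLinear (Z : VectorBundleCore ℂ X ℂ ι) (x y : X) :
    HolSections E Z →ₗ[ℂ] ℂ where
  toFun σ := localRep σ x y
  map_add' σ τ := map_add (Z.coordChange (Z.indexAt y) (Z.indexAt x) y) (σ y) (τ y)
  map_smul' a σ := map_smul (Z.coordChange (Z.indexAt y) (Z.indexAt x) y) a (σ y)

theorem localRepLinear_apply (σ : HolSections E Z) (x y : X) :
    localRepLinear Z x y σ = localRep σ x y := rfl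

theorem localRep_eq_zero_iff (σ : HolSections E Z) {x y : X}
    (hy : y ∈ Z.baseSet (Z.indexAt x)) : localRep σ x y = 0 ↔ σ y = 0 := by
  constructor
  · intro h
    have h1 := localRep_transition σ (Z.mem_baseSet_at y) hy
    rw [h, map_zero, localRep_self] at h1
    exact h1.symm
  · intro h
    have h1 := localRep_transition σ hy (Z.mem_baseSet_at y)
    rw [localRep_self, h] at h1
    exact h1.symm.trans (map_zero (Z.coordChange (Z.indexAt y) (Z.indexAt x) y))

theorem localRep_eq_mul (σ : HolSections E Z) {p q y : X}
    (hp : y ∈ Z.baseSet (Z.indexAt p)) (hq : y ∈ Z.baseSet (Z.indexAt q)) :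
    localRep σ p y =
      Z.coordChange (Z.indexAt q) (Z.indexAt p) y 1 * localRep σ q y := by
  rw [← localRep_transition σ hp hq, mul_comm, ← smul_eq_mul, ← map_smul, smul_eq_mul, mul_one]

theorem coordChange_one_ne_zero {i j : ι} {y : X} (hi : y ∈ Z.baseSet i) (hj : y ∈ Z.baseSet j) :
    Z.coordChange i j y 1 ≠ 0 := by
  intro h
  have h1 := Z.coordChange_comp i j i y ⟨⟨hi, hj⟩, hi⟩ 1
  rw [h, map_zero, Z.coordChange_self i y hi] at h1
  exact zero_ne_one h1

variable [IsManifold 𝓘(ℂ, E) ω X] [Z.IsContMDiff 𝓘(ℂ, E) ω]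

theorem contMDiffAt_localRep (σ : HolSections E Z) {p y : X}
    (hy : y ∈ Z.baseSet (Z.indexAt p)) :
    ContMDiffAt 𝓘(ℂ, E) 𝓘(ℂ, ℂ) ω (localRep σ p) y :=
  (contMDiffOn_localRep σ p).contMDiffAt ((Z.isOpen_baseSet _).mem_nhds hy)

/-- By the Leibniz rule the derivative of the transition function enters multiplied by the value of
the section at `y`, which is zero. -/
theorem mfderiv_localRep_eq_smul (σ : HolSections E Z) {p y : X}
    (hp : y ∈ Z.baseSet (Z.indexAt p)) (h0 : σ y = 0) :
    mfderiv 𝓘(ℂ, E) 𝓘(ℂ, ℂ) (localRep σ p) y =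
      (Z.coordChange (Z.indexAt y) (Z.indexAt p) y 1 •
        (mfderiv 𝓘(ℂ, E) 𝓘(ℂ, ℂ) (localRep σ y) y : E →L[ℂ] ℂ) : E →L[ℂ] ℂ) := by
  have hy := Z.mem_baseSet_at y
  have hev : localRep σ p =ᶠ[𝓝 y]
      (fun y' => Z.coordChange (Z.indexAt y) (Z.indexAt p) y' 1) * localRep σ y := by
    filter_upwards [(Z.isOpen_baseSet _).mem_nhds hp, (Z.isOpen_baseSet _).mem_nhds hy]
      with y' h1 h2 using localRep_eq_mul σ h1 h2
  have hc : ContMDiffAt 𝓘(ℂ, E) 𝓘(ℂ, ℂ) ω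
      (fun y' => Z.coordChange (Z.indexAt y) (Z.indexAt p) y' 1) y :=
    ((Z.contMDiffOn_coordChange 𝓘(ℂ, E) _ _).clm_apply contMDiffOn_const).contMDiffAt
      (((Z.isOpen_baseSet _).inter (Z.isOpen_baseSet _)).mem_nhds ⟨hy, hp⟩)
  have h1 := ((hc.mdifferentiableAt (by simp)).hasMFDerivAt.mul
    ((contMDiffAt_localRep σ hy).mdifferentiableAt (by simp)).hasMFDerivAt)
  rw [hev.mfderiv_eq, h1.mfderiv, localRep_self, h0]
  have aux (a : ℂ) (A B : E →L[ℂ] ℂ) : a • A + (0 : ℂ) • B = a • A := by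
    ext v
    simp
  exact aux _ _ _

theorem contDiffAt_localRep_extChartAt_symm (σ : HolSections E Z) (x : X) :
    ContDiffAt ℂ ω (fun z => localRep σ x ((extChartAt 𝓘(ℂ, E) x).symm z))
      (extChartAt 𝓘(ℂ, E) x x) := by
  have h : ContMDiffAt 𝓘(ℂ, E) 𝓘(ℂ, ℂ) ω
      (fun z => localRep σ x ((extChartAt 𝓘(ℂ, E) x).symm z)) (extChartAt 𝓘(ℂ, E) x x) := by
    refine ContMDiffAt.comp (extChartAt 𝓘(ℂ, E) x x) (g := localRep σ x) ?_
      ((contMDiffOn_extChartAt_symm x).contMDiffAt (extChartAt_target_mem_nhds x))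
    rw [extChartAt_to_inv]
    exact contMDiffAt_localRep σ (Z.mem_baseSet_at x)
  exact contMDiffAt_iff_contDiffAt.1 h

/-- Vanishing of the 1-jet of a section can be tested in any chart and trivialization. -/
theorem oneJet_eq_zero_iff (σ : HolSections E Z) {x y : X}
    (hy : y ∈ Z.baseSet (Z.indexAt x)) (hyc : y ∈ (extChartAt 𝓘(ℂ, E) x).source) :
    (σ y = 0 ∧ mfderiv 𝓘(ℂ, E) 𝓘(ℂ, ℂ) (localRep σ y) y = 0) ↔
      (localRep σ x y = 0 ∧
        fderiv ℂ (fun z => localRep σ x ((extChartAt 𝓘(ℂ, E) x).symm z))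
          (extChartAt 𝓘(ℂ, E) x y) = 0) := by
  rw [localRep_eq_zero_iff σ hy]
  refine and_congr_right fun h0 => ?_
  have : IsManifold 𝓘(ℂ, E) 1 X := IsManifold.of_le (n := ω) (by simp)
  set φ := extChartAt 𝓘(ℂ, E) x with hφ
  set f : E → ℂ := fun z => localRep σ x (φ.symm z) with hf
  -- Change of trivialization at a zero multiplies the derivative by a unit; the change of chart is
  -- the chain rule `h2`, with the invertible derivative of `φ`.
  have h1 : mfderiv 𝓘(ℂ, E) 𝓘(ℂ, ℂ) (localRep σ x) y = 0 ↔
      mfderiv 𝓘(ℂ, E) 𝓘(ℂ, ℂ) (localRep σ y) y = 0 := by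
    rw [mfderiv_localRep_eq_smul σ hy h0]
    exact smul_eq_zero_iff_right (coordChange_one_ne_zero (Z.mem_baseSet_at y) hy)
  rw [← h1]
  have hev : localRep σ x =ᶠ[𝓝 y] f ∘ φ := by
    filter_upwards [(isOpen_extChartAt_source (I := 𝓘(ℂ, E)) x).mem_nhds hyc] with y' hy'
    simp only [hf, Function.comp_apply, φ.left_inv hy']
  have hfd : DifferentiableAt ℂ f (φ y) := by
    refine (differentiableOn_localRep σ x).differentiableAt ?_
    refine Filter.inter_mem (extChartAt_target_mem_nhds' (φ.map_source hyc)) ?_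
    refine (continuousAt_extChartAt_symm' hyc).preimage_mem_nhds ?_
    rw [φ.left_inv hyc]
    exact (Z.isOpen_baseSet _).mem_nhds hy
  have hφd : MDifferentiableAt 𝓘(ℂ, E) 𝓘(ℂ, E) φ y :=
    mdifferentiableAt_extChartAt (by rwa [hφ, extChartAt_source] at hyc)
  have h2 (v : E) : (mfderiv 𝓘(ℂ, E) 𝓘(ℂ, ℂ) (localRep σ x) y : E →L[ℂ] ℂ) v =
      fderiv ℂ f (φ y) ((mfderiv 𝓘(ℂ, E) 𝓘(ℂ, E) φ y : E →L[ℂ] E) v) := by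
    rw [hev.mfderiv_eq, mfderiv_comp y hfd.mdifferentiableAt hφd, mfderiv_eq_fderiv]
    rfl
  have hsurj : Function.Surjective (mfderiv 𝓘(ℂ, E) 𝓘(ℂ, E) φ y : E →L[ℂ] E) :=
    (isInvertible_mfderiv_extChartAt (I := 𝓘(ℂ, E)) hyc).bijective.surjective
  constructor
  · intro h
    ext w
    obtain ⟨v, rfl⟩ := hsurj w
    exact (h2 v).symm.trans (congrArg (fun l : E →L[ℂ] ℂ => l v) h)
  · intro h
    refine ContinuousLinearMap.ext fun v => (h2 v).trans ?_
    rw [h]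
    rfl

end LocalRep

/-- If `A = 0`, the kernel is `E × ker m`, with image the proper subspace `ker m`. If `A u ≠ 0`, any
`τ` lifts to the kernel by a correction along `u`. -/
theorem map_snd_ker_ne_top_iff {E T : Type*} [AddCommGroup E] [Module ℂ E] [AddCommGroup T]
    [Module ℂ T] (D : E × T →ₗ[ℂ] ℂ) (A : E →ₗ[ℂ] ℂ) (m : T →ₗ[ℂ] ℂ)
    (hD : ∀ v, D v = A v.1 + m v.2) (hm : m ≠ 0) :
    (LinearMap.ker D).map (LinearMap.snd ℂ E T) ≠ ⊤ ↔ A = 0 := by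
  rw [not_iff_comm]
  constructor
  · intro hA
    obtain ⟨u, hu⟩ : ∃ u, A u ≠ 0 := by
      by_contra! h
      exact hA (LinearMap.ext h)
    refine eq_top_iff.2 fun τ _ => ⟨(-(m τ / A u) • u, τ), ?_, rfl⟩
    simp [hD, hu]
  · rintro h rfl
    refine hm (LinearMap.ext fun τ => ?_)
    obtain ⟨v, hv, hvτ⟩ := h.ge (Submodule.mem_top (x := τ))
    have h1 := hD v
    rw [LinearMap.mem_ker.1 hv] at h1
    change v.2 = τ at hvτ
    simpa [hvτ] using h1.symm

/-! ### The universal family and its critical locus. -/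

section Family

variable {X : Type*} [TopologicalSpace X] {ι : Type*}
  {E : Type*} [NormedAddCommGroup E] [NormedSpace ℂ E] [ChartedSpace E X]
  {Z : VectorBundleCore ℂ X ℂ ι} [FiniteDimensional ℂ (HolSections E Z)]

/-- The linear part of the value at `y` of the section with affine coordinates `t`. -/
noncomputable def affineLiftValue (s : LinearSystem E Z) (x y : X) :
    (Fin (projDim (HolSections E Z)) → ℂ) →ₗ[ℂ] ℂ :=
  localRepLinear Z x y ∘ₗ (homogCoord s).symm.toLinearMap ∘ₗ LinearMap.inr ℂ ℂ _

theorem localRep_affineLift (s : LinearSystem E Z) (x y : X)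
    (t : Fin (projDim (HolSections E Z)) → ℂ) :
    localRep (affineLift s t) x y = localRep s.rep x y + affineLiftValue s x y t := by
  rw [affineLift_eq_add, ← localRepLinear_apply, map_add]
  rfl

/-- Sections are spanned by `s.rep`, which vanishes at `x`, and by the sections `(0, t)` in
homogeneous coordinates. If the latter also vanished at `x`, then `x` would be a base point. -/
theorem affineLiftValue_ne_zero {s : LinearSystem E Z} {x : X} (hs : s.rep x = 0)
    (hb : ∃ σ : HolSections E Z, σ x ≠ 0) : affineLiftValue s x x ≠ 0 := by
  intro h
  obtain ⟨σ, hσ⟩ := hb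
  apply hσ
  have h1 : σ = (homogCoord s σ).1 • s.rep + (homogCoord s).symm (0, (homogCoord s σ).2) := by
    apply (homogCoord s).injective
    rw [map_add, map_smul, homogCoord_rep, LinearEquiv.apply_symm_apply]
    ext <;> simp
  have h2 : localRepLinear Z x x ((homogCoord s).symm (0, (homogCoord s σ).2)) = 0 :=
    congrArg (fun l : (Fin (projDim (HolSections E Z)) → ℂ) →ₗ[ℂ] ℂ => l (homogCoord s σ).2) h
  have h3 : localRepLinear Z x x s.rep = 0 := (localRep_self _ _).trans hs
  rw [← localRep_self σ x, ← localRepLinear_apply, h1, map_add, map_smul, h2, h3, smul_zero,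
    add_zero]
  rfl

/-- The local equation of the universal family at `p`, in the coordinates at `p`. -/
noncomputable def familyChartEquation (p : X × LinearSystem E Z)
    (w : E × (Fin (projDim (HolSections E Z)) → ℂ)) : ℂ :=
  localRep (affineLift p.2 w.2) p.1 ((extChartAt 𝓘(ℂ, E) p.1).symm w.1)

theorem familyEquation_eventuallyEq (p : X × LinearSystem E Z) :
    familyEquation p =ᶠ[𝓝 p] familyChartEquation p ∘
      extChartAt (𝓘(ℂ, E).prod 𝓘(ℂ, Fin (projDim (HolSections E Z)) → ℂ)) p := by
  have h : ∀ᶠ q in 𝓝 p, q.1 ∈ (extChartAt 𝓘(ℂ, E) p.1).source :=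
    continuous_fst.continuousAt.eventually (extChartAt_source_mem_nhds p.1)
  filter_upwards [h] with q hq
  simp only [Function.comp_apply, familyChartEquation, extChartAt_prod, PartialEquiv.prod_coe,
    extChartAt_eq_affineChart, familyEquation]
  rw [PartialEquiv.left_inv _ hq]

/-- In the affine chart the function is affine with linear part `affineLiftValue s x x`, and the
derivative of the chart is onto. -/
theorem mfderiv_affineLiftValue_ne_zero {s : LinearSystem E Z} {x : X} (hs : s.rep x = 0)
    (hb : ∃ σ : HolSections E Z, σ x ≠ 0) :
    (mfderiv 𝓘(ℂ, Fin (projDim (HolSections E Z)) → ℂ) 𝓘(ℂ, ℂ)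
      (fun t => localRep (affineLift s (affineChart s t)) x x) s :
        (Fin (projDim (HolSections E Z)) → ℂ) →L[ℂ] ℂ) ≠ 0 := by
  have : IsManifold 𝓘(ℂ, Fin (projDim (HolSections E Z)) → ℂ) 1 (LinearSystem E Z) :=
    IsManifold.of_le (n := ω) (by simp)
  set κ := extChartAt 𝓘(ℂ, Fin (projDim (HolSections E Z)) → ℂ) s with hκ
  let l := (affineLiftValue s x x).toContinuousLinearMap
  have h1 : (fun t => localRep (affineLift s (affineChart s t)) x x) =
      (fun t => localRep s.rep x x + l t) ∘ κ := by
    ext t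
    rw [localRep_affineLift, Function.comp_apply, hκ, extChartAt_eq_affineChart]
    rfl
  have hd : HasFDerivAt (fun t => localRep s.rep x x + l t) l (κ s) :=
    l.hasFDerivAt.const_add _
  have h2 := HasMFDerivAt.comp s hd.hasMFDerivAt
    (mdifferentiableAt_extChartAt (I := 𝓘(ℂ, Fin (projDim (HolSections E Z)) → ℂ))
      (mem_chart_source _ s)).hasMFDerivAt
  rw [h1, h2.mfderiv]
  intro h0
  apply affineLiftValue_ne_zero hs hb
  have hsurj : Function.Surjective
      (mfderiv 𝓘(ℂ, Fin (projDim (HolSections E Z)) → ℂ)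
        𝓘(ℂ, Fin (projDim (HolSections E Z)) → ℂ) κ s :
        (Fin (projDim (HolSections E Z)) → ℂ) →L[ℂ] (Fin (projDim (HolSections E Z)) → ℂ)) :=
    (isInvertible_mfderiv_extChartAt (mem_extChartAt_source s)).bijective.surjective
  refine LinearMap.ext fun τ => ?_
  obtain ⟨v, rfl⟩ := hsurj τ
  exact congrArg (fun m : (Fin (projDim (HolSections E Z)) → ℂ) →L[ℂ] ℂ => m v) h0

variable [IsManifold 𝓘(ℂ, E) ω X] [Z.IsContMDiff 𝓘(ℂ, E) ω]

/-- Joint holomorphy follows from affineness in `t`: the equation is a fixed local function plus a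
finite sum of coordinates `t i` times local functions of fixed sections. -/
theorem contDiffAt_familyChartEquation (p : X × LinearSystem E Z)
    (t : Fin (projDim (HolSections E Z)) → ℂ) :
    ContDiffAt ℂ ω (familyChartEquation p) (extChartAt 𝓘(ℂ, E) p.1 p.1, t) := by
  classical
  have h (w : E × (Fin (projDim (HolSections E Z)) → ℂ)) : familyChartEquation p w =
      localRep p.2.rep p.1 ((extChartAt 𝓘(ℂ, E) p.1).symm w.1) +
        ∑ i, w.2 i * localRep ((homogCoord p.2).symm (0, fun j => if i = j then 1 else 0)) p.1
          ((extChartAt 𝓘(ℂ, E) p.1).symm w.1) := by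
    rw [familyChartEquation, localRep_affineLift, LinearMap.pi_apply_eq_sum_univ]
    rfl
  have hσ (σ : HolSections E Z) : ContDiffAt ℂ ω
      (fun w : E × (Fin (projDim (HolSections E Z)) → ℂ) =>
        localRep σ p.1 ((extChartAt 𝓘(ℂ, E) p.1).symm w.1))
      (extChartAt 𝓘(ℂ, E) p.1 p.1, t) :=
    (contDiffAt_localRep_extChartAt_symm σ p.1).comp (extChartAt 𝓘(ℂ, E) p.1 p.1, t) contDiffAt_fst
  rw [show familyChartEquation p = _ from funext h]
  refine (hσ _).add (ContDiffAt.sum fun i _ => ContDiffAt.mul ?_ (hσ _))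
  exact (contDiff_apply ℂ ℂ i).contDiffAt.comp _ contDiffAt_snd

theorem mdifferentiableAt_familyEquation (p : X × LinearSystem E Z) :
    MDifferentiableAt (𝓘(ℂ, E).prod 𝓘(ℂ, Fin (projDim (HolSections E Z)) → ℂ)) 𝓘(ℂ, ℂ)
      (familyEquation p) p := by
  refine MDifferentiableAt.congr_of_eventuallyEq ?_ (familyEquation_eventuallyEq p)
  refine MDifferentiableAt.comp p (I' := 𝓘(ℂ, E × (Fin (projDim (HolSections E Z)) → ℂ))) ?_
    (mdifferentiableAt_extChartAt (mem_chart_source _ _))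
  refine DifferentiableAt.mdifferentiableAt ?_
  rw [extChartAt_prod, PartialEquiv.prod_coe]
  exact (contDiffAt_familyChartEquation p _).differentiableAt (by simp)

/-- At a point which is not a base point, the critical locus is the set of `(x, s)` such that the
1-jet of `s` at `x` vanishes. -/
theorem mem_criticalLocus_iff (p : X × LinearSystem E Z)
    (hb : ∃ σ : HolSections E Z, σ p.1 ≠ 0) :
    p ∈ criticalLocus E Z ↔
      (p.2.rep p.1 = 0 ∧ mfderiv 𝓘(ℂ, E) 𝓘(ℂ, ℂ) (localRep p.2.rep p.1) p.1 = 0) := by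
  refine and_congr_right fun h0 => ?_
  have h0' : p.2.rep p.1 = 0 := h0
  have h1 : (fun y => familyEquation p (y, p.2)) = localRep p.2.rep p.1 := by
    ext y
    rw [familyEquation, affineLift_affineChart_self]
  -- The differential of the local equation splits into its partial derivatives; by `h1` the one
  -- along `X` is the derivative of the section itself.
  have key := map_snd_ker_ne_top_iff
    (E := E) (T := Fin (projDim (HolSections E Z)) → ℂ)
    (mfderiv (𝓘(ℂ, E).prod 𝓘(ℂ, Fin (projDim (HolSections E Z)) → ℂ)) 𝓘(ℂ, ℂ)
      (familyEquation p) p).toLinearMap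
    (mfderiv 𝓘(ℂ, E) 𝓘(ℂ, ℂ) (localRep p.2.rep p.1) p.1).toLinearMap
    (mfderiv 𝓘(ℂ, Fin (projDim (HolSections E Z)) → ℂ) 𝓘(ℂ, ℂ)
      (fun t => localRep (affineLift p.2 (affineChart p.2 t)) p.1 p.1) p.2).toLinearMap
    (fun v => by
      rw [← h1]
      exact mfderiv_prod_eq_add_apply (mdifferentiableAt_familyEquation p))
    (fun h => mfderiv_affineLiftValue_ne_zero h0' hb
      (ContinuousLinearMap.coe_injective h))
  rw [mfderiv_snd]
  exact key.trans ⟨fun h => ContinuousLinearMap.coe_injective h, fun h => congrArg _ h⟩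

end Family

/-! ### Germs of graphs over smooth hypersurfaces. -/

section Germs

/-- Smoothness may be tested in the chart and with equations valued in any finite-dimensional space
`W`, since the chart has invertible derivative and `W` is linearly isomorphic to some `ℂ ^ c`. -/
theorem isSmoothGerm_of_extChartAt {E H M : Type*} [NormedAddCommGroup E] [NormedSpace ℂ E]
    [TopologicalSpace H] {I : ModelWithCorners ℂ E H} [TopologicalSpace M] [ChartedSpace H M]
    [IsManifold I 1 M] {W : Type*} [NormedAddCommGroup W] [NormedSpace ℂ W]
    [FiniteDimensional ℂ W] {A : Set M} {p : M} {G : E → W}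
    (hG : ContDiffAt ℂ ω G (extChartAt I p p))
    (hs : Function.Surjective (fderiv ℂ G (extChartAt I p p))) (h0 : G (extChartAt I p p) = 0)
    (hA : ∀ᶠ y in 𝓝 p, (y ∈ A ↔ G (extChartAt I p y) = 0)) : IsSmoothGerm I A p := by
  let e : W ≃L[ℂ] (Fin (Module.finrank ℂ W) → ℂ) :=
    (LinearEquiv.ofFinrankEq W (Fin (Module.finrank ℂ W) → ℂ) (by simp)).toContinuousLinearEquiv
  have heG : ContDiffAt ℂ ω (fun z => e (G z)) (extChartAt I p p) :=
    e.contDiff.contDiffAt.comp _ hG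
  refine ⟨Module.finrank ℂ W, fun y => e (G (extChartAt I p y)), ?_, ?_, by beta_reduce; rw [h0, map_zero], ?_⟩
  · exact heG.contMDiffAt.comp p contMDiffAt_extChartAt
  · have h1 : HasFDerivAt (fun z => e (G z))
        ((e : W →L[ℂ] _).comp (fderiv ℂ G (extChartAt I p p))) (extChartAt I p p) :=
      e.hasFDerivAt.comp _ (hG.differentiableAt (by simp)).hasFDerivAt
    have h2 := HasMFDerivAt.comp p h1.hasMFDerivAt
      (mdifferentiableAt_extChartAt (I := I) (mem_chart_source _ p)).hasMFDerivAt
    have h3 : mfderiv I 𝓘(ℂ, Fin (Module.finrank ℂ W) → ℂ)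
      (fun y => e (G (extChartAt I p y))) p = _ := h2.mfderiv
    rw [h3]
    have hsurj : Function.Surjective (mfderiv I 𝓘(ℂ, E) (extChartAt I p) p) :=
      (isInvertible_mfderiv_extChartAt (mem_extChartAt_source p)).bijective.surjective
    exact (e.surjective.comp hs).comp hsurj
  · filter_upwards [hA] with y hy
    rw [hy, map_eq_zero_iff e e.injective]

/-- A subset of a product which is, near a point, the graph of a holomorphic map over a smooth
hypersurface of the second factor: it is smooth and projects isomorphically to its image. -/
theorem exists_image_germ_of_graph {E T M N : Type*} [NormedAddCommGroup E] [NormedSpace ℂ E]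
    [FiniteDimensional ℂ E] [NormedAddCommGroup T] [NormedSpace ℂ T]
    [TopologicalSpace M] [ChartedSpace E M] [IsManifold 𝓘(ℂ, E) ω M]
    [TopologicalSpace N] [ChartedSpace T N] [IsManifold 𝓘(ℂ, T) ω N]
    {A : Set (M × N)} {x : M} {s : N} {ζ : T → E} {h : T → ℂ}
    (hζ : ContDiffAt ℂ ω ζ (extChartAt 𝓘(ℂ, T) s s))
    (hζ0 : ζ (extChartAt 𝓘(ℂ, T) s s) = extChartAt 𝓘(ℂ, E) x x)
    (hh : ContDiffAt ℂ ω h (extChartAt 𝓘(ℂ, T) s s)) (hh0 : h (extChartAt 𝓘(ℂ, T) s s) = 0)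
    (hd : fderiv ℂ h (extChartAt 𝓘(ℂ, T) s s) ≠ 0)
    (hA : ∀ᶠ q in 𝓝 (x, s), (q ∈ A ↔ extChartAt 𝓘(ℂ, E) x q.1 = ζ (extChartAt 𝓘(ℂ, T) s q.2) ∧
      h (extChartAt 𝓘(ℂ, T) s q.2) = 0)) :
    ∃ D : Set N, IsImageGerm Prod.snd A (x, s) D ∧
      IsGermIso (𝓘(ℂ, E).prod 𝓘(ℂ, T)) 𝓘(ℂ, T) Prod.snd A (x, s) D ∧
      IsSmoothGerm (𝓘(ℂ, E).prod 𝓘(ℂ, T)) A (x, s) ∧ IsSmoothGerm 𝓘(ℂ, T) D s := by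
  have : IsManifold 𝓘(ℂ, E) 1 M := IsManifold.of_le (n := ω) (by simp)
  have : IsManifold 𝓘(ℂ, T) 1 N := IsManifold.of_le (n := ω) (by simp)
  set φ := extChartAt 𝓘(ℂ, E) x with hφ
  set κ := extChartAt 𝓘(ℂ, T) s with hκ
  -- Only the germ of `D` at `s` matters; values of `κ` outside the chart domain are irrelevant.
  let D : Set N := {s' | h (κ s') = 0}
  let g : N → M × N := fun s' => (φ.symm (ζ (κ s')), s')
  have hg0 : g s = (x, s) := by
    simp only [g, hζ0, hφ, extChartAt_to_inv]
  have hζκ : ContMDiffAt 𝓘(ℂ, T) 𝓘(ℂ, E) ω (fun s' => ζ (κ s')) s :=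
    hζ.contMDiffAt.comp s contMDiffAt_extChartAt
  have hg : ContMDiffAt 𝓘(ℂ, T) (𝓘(ℂ, E).prod 𝓘(ℂ, T)) ω g s := by
    refine ContMDiffAt.prodMk (ContMDiffAt.comp s (g := φ.symm) ?_ hζκ) contMDiffAt_id
    rw [hζ0]
    exact (contMDiffOn_extChartAt_symm x).contMDiffAt (extChartAt_target_mem_nhds x)
  have hgc : Filter.Tendsto g (𝓝 s) (𝓝 (x, s)) := by
    have := hg.continuousAt
    rwa [ContinuousAt, hg0] at this
  have hgA : ∀ᶠ s' in 𝓝 s, s' ∈ D → g s' ∈ A := by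
    have h1 : ∀ᶠ s' in 𝓝 s, ζ (κ s') ∈ φ.target := by
      refine hζκ.continuousAt.eventually_mem ?_
      rw [hζ0]
      exact extChartAt_target_mem_nhds x
    filter_upwards [h1, hgc.eventually hA] with s' h1 h2 h3
    exact h2.2 ⟨φ.right_inv h1, h3⟩
  have hxA : (x, s) ∈ A := hA.self_of_nhds.2 ⟨hζ0.symm, hh0⟩
  -- `U₀` is the set where the graph description `hA` holds. Inside it `A` projects into `D`;
  -- conversely, continuity of `g` puts `g s'` in `U` for `s'` close to `s`.
  refine ⟨D, ⟨_, hA, fun U hU hUA => ?_⟩, ⟨hxA, hh0, contMDiffAt_snd, g, hg0, hg, ?_, ?_⟩, ?_, ?_⟩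
  · filter_upwards [hgA, hgc.eventually hU] with s' h1 h2
    constructor
    · rintro ⟨q, ⟨hqA, hqU⟩, rfl⟩
      exact ((hUA hqU).1 hqA).2
    · intro hD
      exact ⟨g s', ⟨h1 hD, h2⟩, rfl⟩
  · have h1 : ∀ᶠ q : M × N in 𝓝 (x, s), q.1 ∈ φ.source :=
      continuous_fst.continuousAt.eventually (extChartAt_source_mem_nhds x)
    filter_upwards [hA, h1] with q hq hqs hqA
    obtain ⟨h2, h3⟩ := hq.1 hqA
    refine ⟨h3, Prod.ext ?_ rfl⟩
    simp only [g]
    rw [← h2, φ.left_inv hqs]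
  · filter_upwards [hgA] with s' hs' hD using ⟨hs' hD, rfl⟩
  · have hp : extChartAt (𝓘(ℂ, E).prod 𝓘(ℂ, T)) (x, s) (x, s) = (φ x, κ s) := by
      rw [extChartAt_prod]; rfl
    -- Equations of the graph over the hypersurface: `z = ζ t` and `h t = 0`.
    refine isSmoothGerm_of_extChartAt (W := E × ℂ) (G := fun w => (w.1 - ζ w.2, h w.2)) ?_ ?_ ?_ ?_
    · rw [hp]
      exact (contDiffAt_fst.sub (hζ.comp (φ x, κ s) contDiffAt_snd)).prodMk
        (hh.comp (φ x, κ s) contDiffAt_snd)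
    · rw [hp]
      have h1 : HasFDerivAt (fun w : E × T => (w.1 - ζ w.2, h w.2))
          ((ContinuousLinearMap.fst ℂ E T -
            (fderiv ℂ ζ (κ s)).comp (ContinuousLinearMap.snd ℂ E T)).prod
            ((fderiv ℂ h (κ s)).comp (ContinuousLinearMap.snd ℂ E T))) (φ x, κ s) := by
        refine HasFDerivAt.prodMk (hasFDerivAt_fst.sub ?_) ?_
        · exact HasFDerivAt.comp (φ x, κ s) (g := ζ)
            (hζ.differentiableAt (by simp)).hasFDerivAt hasFDerivAt_snd
        · exact HasFDerivAt.comp (φ x, κ s) (g := h)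
            (hh.differentiableAt (by simp)).hasFDerivAt hasFDerivAt_snd
      rw [h1.fderiv]
      rintro ⟨u, a⟩
      obtain ⟨τ, hτ⟩ := LinearMap.surjective (f := (fderiv ℂ h (κ s)).toLinearMap)
        (fun h0 => hd (ContinuousLinearMap.coe_injective h0)) a
      -- The derivative is triangular: `τ` is fixed by the second component, and the first is then
      -- corrected by the slope of the graph.
      refine ⟨(u + fderiv ℂ ζ (κ s) τ, τ), ?_⟩
      change fderiv ℂ h (κ s) τ = a at hτ
      simp [hτ]
    · rw [hp]
      simp [hζ0, hh0]
    · filter_upwards [hA] with q hq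
      rw [hq, extChartAt_prod]
      simp only [PartialEquiv.prod_coe, Prod.mk_eq_zero, sub_eq_zero]
      rfl
  · exact isSmoothGerm_of_extChartAt hh
      (LinearMap.surjective (f := (fderiv ℂ h (κ s)).toLinearMap)
        fun h0 => hd (ContinuousLinearMap.coe_injective h0)) hh0 (Filter.Eventually.of_forall fun _ => Iff.rfl)

end Germs

/-! ### The critical locus near an ordinary double point. -/

section CriticalLocus

variable {X : Type*} [TopologicalSpace X] {ι : Type*}
  {E : Type*} [NormedAddCommGroup E] [NormedSpace ℂ E] [ChartedSpace E X]
  {Z : VectorBundleCore ℂ X ℂ ι} [FiniteDimensional ℂ (HolSections E Z)]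
  [IsManifold 𝓘(ℂ, E) ω X] [Z.IsContMDiff 𝓘(ℂ, E) ω]

/-- The critical locus near `p`, in the coordinates at `p`. -/
theorem eventually_mem_criticalLocus_iff (hb : ∀ x : X, ∃ σ : HolSections E Z, σ x ≠ 0)
    (p : X × LinearSystem E Z) :
    ∀ᶠ q in 𝓝 p, (q ∈ criticalLocus E Z ↔
      (familyChartEquation p (extChartAt 𝓘(ℂ, E) p.1 q.1, affineChart p.2 q.2) = 0 ∧
        fderiv ℂ (fun z => familyChartEquation p (z, affineChart p.2 q.2))
          (extChartAt 𝓘(ℂ, E) p.1 q.1) = 0)) := by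
  have h1 : ∀ᶠ q in 𝓝 p, q.1 ∈ (extChartAt 𝓘(ℂ, E) p.1).source :=
    continuous_fst.continuousAt.eventually (extChartAt_source_mem_nhds p.1)
  have h2 : ∀ᶠ q in 𝓝 p, q.1 ∈ Z.baseSet (Z.indexAt p.1) :=
    continuous_fst.continuousAt.eventually ((Z.isOpen_baseSet _).mem_nhds (Z.mem_baseSet_at p.1))
  have h3 : ∀ᶠ q in 𝓝 p, q.2 ∈ (affineChart p.2).source := by
    rw [← extChartAt_eq_affineChart]
    exact continuous_snd.continuousAt.eventually (extChartAt_source_mem_nhds p.2)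
  filter_upwards [h1, h2, h3] with q h1 h2 h3
  -- Membership of `q` is defined in coordinates centred at `q`; invariance of the 1-jet condition
  -- moves it to the fixed coordinates at `p`.
  rw [mem_criticalLocus_iff q (hb q.1), oneJet_eq_zero_iff _ h2 h1]
  obtain ⟨a, ha, h⟩ := affineLift_affineChart h3
  have h4 (z : E) : familyChartEquation p (z, affineChart p.2 q.2) =
      a • localRep q.2.rep p.1 ((extChartAt 𝓘(ℂ, E) p.1).symm z) := by
    simp only [familyChartEquation, h]
    exact map_smul (localRepLinear Z p.1 _) a q.2.rep
  simp only [h4]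
  have h5 : fderiv ℂ (fun z => a • localRep q.2.rep p.1 ((extChartAt 𝓘(ℂ, E) p.1).symm z))
      (extChartAt 𝓘(ℂ, E) p.1 q.1) =
      a • fderiv ℂ (fun z => localRep q.2.rep p.1 ((extChartAt 𝓘(ℂ, E) p.1).symm z))
        (extChartAt 𝓘(ℂ, E) p.1 q.1) :=
    congrFun (fderiv_const_smul_field a) _
  rw [h5, PartialEquiv.left_inv _ h1, smul_eq_zero_iff_right ha]
  refine and_congr_right fun _ => ?_
  exact (smul_eq_zero_iff_right ha).symm

theorem exists_image_germ_criticalLocus [FiniteDimensional ℂ E]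
    (hb : ∀ x : X, ∃ σ : HolSections E Z, σ x ≠ 0) {s₀ : LinearSystem E Z} {x₀ : X}
    (hx₀ : IsOrdinaryDoublePoint s₀ x₀) :
    ∃ D : Set (LinearSystem E Z),
      IsImageGerm Prod.snd (criticalLocus E Z) (x₀, s₀) D ∧
      IsGermIso (𝓘(ℂ, E).prod 𝓘(ℂ, Fin (projDim (HolSections E Z)) → ℂ))
        𝓘(ℂ, Fin (projDim (HolSections E Z)) → ℂ) Prod.snd (criticalLocus E Z) (x₀, s₀) D ∧
      IsSmoothGerm (𝓘(ℂ, E).prod 𝓘(ℂ, Fin (projDim (HolSections E Z)) → ℂ))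
        (criticalLocus E Z) (x₀, s₀) ∧
      IsSmoothGerm 𝓘(ℂ, Fin (projDim (HolSections E Z)) → ℂ) D s₀ := by
  obtain ⟨hf0, hf1, hf2⟩ := hx₀
  have hs0 : s₀.rep x₀ = 0 := by
    beta_reduce at hf0
    rwa [extChartAt_to_inv, localRep_self] at hf0
  have hslice : (fun z => familyChartEquation (x₀, s₀) (z, affineChart s₀ s₀)) =
      fun z => localRep s₀.rep x₀ ((extChartAt 𝓘(ℂ, E) x₀).symm z) := by
    ext z
    simp only [familyChartEquation, affineLift_affineChart_self]
  -- With the point of `X` frozen at `x₀`, the equation is affine in `t`, and its linear part is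
  -- nonzero because `x₀` is not a base point.
  have ht : fderiv ℂ (fun t => familyChartEquation (x₀, s₀) (extChartAt 𝓘(ℂ, E) x₀ x₀, t))
      (affineChart s₀ s₀) ≠ 0 := by
    let l := (affineLiftValue s₀ x₀ x₀).toContinuousLinearMap
    have h1 : (fun t => familyChartEquation (x₀, s₀) (extChartAt 𝓘(ℂ, E) x₀ x₀, t)) =
        fun t => localRep s₀.rep x₀ x₀ + l t := by
      ext t
      simp only [familyChartEquation, localRep_affineLift, extChartAt_to_inv]
      rfl
    have h2 : HasFDerivAt (fun t => localRep s₀.rep x₀ x₀ + l t) l (affineChart s₀ s₀) :=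
      l.hasFDerivAt.const_add _
    rw [h1, h2.fderiv]
    intro h3
    refine affineLiftValue_ne_zero hs0 (hb x₀) (LinearMap.ext fun τ => ?_)
    exact congrArg (fun m : (Fin (projDim (HolSections E Z)) → ℂ) →L[ℂ] ℂ => m τ) h3
  obtain ⟨ζ, hζ0, hζ, hh, hhd, hev⟩ := exists_critical_point_map
    (contDiffAt_familyChartEquation (x₀, s₀) (affineChart s₀ s₀))
    (by rw [hslice]; exact hf1) (by rw [hslice]; exact hf2) ht
  have hκ := extChartAt_eq_affineChart s₀
  refine exists_image_germ_of_graph (ζ := ζ)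
    (h := fun t => familyChartEquation (x₀, s₀) (ζ t, t)) ?_ ?_ ?_ ?_ ?_ ?_
  · rwa [hκ]
  · rwa [hκ]
  · rwa [hκ]
  · rw [hκ]
    simp only [hζ0]
    exact (congrFun hslice _).trans hf0
  · rwa [hκ]
  · rw [hκ]
    have hc : Filter.Tendsto
        (fun q : X × LinearSystem E Z => (extChartAt 𝓘(ℂ, E) x₀ q.1, affineChart s₀ q.2))
        (𝓝 (x₀, s₀)) (𝓝 (extChartAt 𝓘(ℂ, E) x₀ x₀, affineChart s₀ s₀)) := by
      rw [← hκ]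
      exact (ContinuousAt.comp (f := Prod.fst) (x := (x₀, s₀)) (continuousAt_extChartAt x₀)
        continuousAt_fst).prodMk
        (ContinuousAt.comp (f := Prod.snd) (x := (x₀, s₀)) (continuousAt_extChartAt s₀)
          continuousAt_snd)
    filter_upwards [eventually_mem_criticalLocus_iff hb (x₀, s₀), hc.eventually hev] with q h1 h2
    exact h1.trans h2

end CriticalLocus

theorem proposition2p9 {n : ℕ} {X : Type*} [TopologicalSpace X] [T2Space X] [CompactSpace X]
    [ConnectedSpace X] [ChartedSpace (EuclideanSpace ℂ (Fin (2 * n))) X]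
    [IsManifold 𝓘(ℂ, EuclideanSpace ℂ (Fin (2 * n))) ω X]
    {ι : Type*} (L : VectorBundleCore ℂ X ℂ ι)
    [L.IsContMDiff 𝓘(ℂ, EuclideanSpace ℂ (Fin (2 * n))) ω]
    (k : ℕ) (hk : 0 < k) (hL : IsVeryAmple (EuclideanSpace ℂ (Fin (2 * n))) (L.tensorPow k))
    (s₀ : LinearSystem (EuclideanSpace ℂ (Fin (2 * n))) (L.tensorPow k)) (x₀ : X)
    (hx₀ : IsOrdinaryDoublePoint s₀ x₀) :
    ∃ D : Set (LinearSystem (EuclideanSpace ℂ (Fin (2 * n))) (L.tensorPow k)),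
      IsImageGerm Prod.snd (criticalLocus (EuclideanSpace ℂ (Fin (2 * n))) (L.tensorPow k))
        (x₀, s₀) D ∧
      IsGermIso
        (𝓘(ℂ, EuclideanSpace ℂ (Fin (2 * n))).prod
          𝓘(ℂ, Fin (projDim (HolSections (EuclideanSpace ℂ (Fin (2 * n))) (L.tensorPow k))) → ℂ))
        𝓘(ℂ, Fin (projDim (HolSections (EuclideanSpace ℂ (Fin (2 * n))) (L.tensorPow k))) → ℂ)
        Prod.snd (criticalLocus (EuclideanSpace ℂ (Fin (2 * n))) (L.tensorPow k)) (x₀, s₀) D ∧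
      IsSmoothGerm
        (𝓘(ℂ, EuclideanSpace ℂ (Fin (2 * n))).prod
          𝓘(ℂ, Fin (projDim (HolSections (EuclideanSpace ℂ (Fin (2 * n))) (L.tensorPow k))) → ℂ))
        (criticalLocus (EuclideanSpace ℂ (Fin (2 * n))) (L.tensorPow k)) (x₀, s₀) ∧
      IsSmoothGerm
        𝓘(ℂ, Fin (projDim (HolSections (EuclideanSpace ℂ (Fin (2 * n))) (L.tensorPow k))) → ℂ)
        D s₀ := by
  exact exists_image_germ_criticalLocus hL.1 hx₀
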